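/- Let $\mathcal M$ be a type $\mathrm{II}_1$ factor with its unique normalized (faithful normal) trace $\mathrm{tr}$, operator norm $\|\cdot\|$, and $\|x\|_2=\mathrm{tr}(x^*x)^{1/2}$. For a von Neumann subalgebra $\mathcal N\subseteq\mathcal M$ let $\mathbb E_{\mathcal N}$ be the trace-preserving conditional expectation of $\mathcal M$ onto $\mathcal N$, and for a map $\phi:\mathcal M\to\mathcal M$ put $\|\phi\|_{\infty,2}=\sup\{\|\phi(x)\|_2 : x\in\mathcal M,\ \|x\|\le 1\}$. Let $\mathcal A$ be a masa (maximal abelian self-adjoint subalgebra) in $\mathcal M$. For real $\alpha$, $\mathcal A$ is called $\alpha$-strongly singular if $$\|\mathbb E_{u\mathcal Au^*}-\mathbb E_{\mathcal A}\|_{\infty,2}\ \ge\ \alpha\,\|u-\mathbb E_{\mathcal A}(u)\|_2\qquad\text{for all unitaries }u\in\mathcal M,$$ and strongly singular if this holds with $\alpha=1$; $\alpha(\mathcal A)$ denotes the supremum of all such $\alpha$. For a non-zero partial isometry $v\in\mathcal M$ such that $vv^*$ and $v^*v$ are orthogonal projections in $\mathcal A$, put $$\delta(v\mathcal Av^*,\mathcal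 A)=\sup\{\|x-\mathbb E_{\mathcal A}(x)\|_2 : x\in v\mathcal Av^*,\ \|x\|\le 1\},$$ and let $\delta(\mathcal A)$ be the largest number $\lambda$ such that $\delta(v\mathcal Av^*,\mathcal A)\ge\lambda\|v^*v\|_2$ for all such $v$. **Theorem 7.1.** Every masa $\mathcal A$ in a type $\mathrm{II}_1$ factor satisfies $\delta(\mathcal A)\ge\alpha(\mathcal A)/\sqrt5$. In particular, $\delta(\mathcal A)\ge 1/\sqrt5$ for every strongly singular masa $\mathcal A$. -/

import Mathlib

open Filter Topology
open scoped ComplexOrder InnerProductSpace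

noncomputable section

namespace IIOne

universe u

variable {H : Type u} [NormedAddCommGroup H] [InnerProductSpace ℂ H] [CompleteSpace H]

/-- A von Neumann algebra is a factor if its centre consists of the scalars. -/
def IsFactor (M : VonNeumannAlgebra H) : Prop :=
  ∀ x ∈ M, x ∈ M.commutant → ∃ c : ℂ, x = c • (1 : H →L[ℂ] H)

/-- `τ` is a faithful normal tracial state on `M`. Normality is continuity for the weak
operator topology on the unit ball of `M` (equivalently, ultraweak continuity). -/
structure IsNormalizedTrace {M : VonNeumannAlgebra H} (τ : M.toStarSubalgebra →ₗ[ℂ] ℂ) :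
    Prop where
  map_one : τ 1 = 1
  nonneg : ∀ x, 0 ≤ τ (star x * x)
  faithful : ∀ x, τ (star x * x) = 0 → x = 0
  tracial : ∀ x y, τ (x * y) = τ (y * x)
  normal : ∀ (l : Filter M.toStarSubalgebra) (x : M.toStarSubalgebra),
    (∀ᶠ y : M.toStarSubalgebra in l, ‖(y : H →L[ℂ] H)‖ ≤ 1) → ‖(x : H →L[ℂ] H)‖ ≤ 1 →
    (∀ ξ η : H, Tendsto (fun y : M.toStarSubalgebra => ⟪ξ, (y : H →L[ℂ] H) η⟫_ℂ) l
      (𝓝 ⟪ξ, (x : H →L[ℂ] H) η⟫_ℂ)) →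
    Tendsto τ l (𝓝 (τ x))

/-- A type II₁ factor: an infinite dimensional factor with a faithful normal tracial state
(which is then the only tracial state). -/
structure IsTypeIIOneFactor (M : VonNeumannAlgebra H) : Prop where
  factor : IsFactor M
  infinite_dimensional : ¬ FiniteDimensional ℂ M.toStarSubalgebra
  exists_trace : ∃ τ : M.toStarSubalgebra →ₗ[ℂ] ℂ, IsNormalizedTrace τ

/-- `A` is a masa in `M`: it is maximal among the abelian self-adjoint subalgebras of `M`. -/
def IsMasa (M A : VonNeumannAlgebra H) : Prop :=
  Maximal (fun B : StarSubalgebra ℂ (H →L[ℂ] H) =>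
    B ≤ M.toStarSubalgebra ∧ ∀ x ∈ B, ∀ y ∈ B, x * y = y * x) A.toStarSubalgebra

theorem centralizer_image_mulEquiv {R : Type*} [Mul R] (e : R ≃* R) (S : Set R) :
    Set.centralizer (e '' S) = e '' Set.centralizer S := by
  ext x
  constructor
  · intro hx
    refine ⟨e.symm x, fun s hs => ?_, e.apply_symm_apply x⟩
    apply e.injective
    simpa using hx (e s) ⟨s, hs, rfl⟩
  · rintro ⟨y, hy, rfl⟩ _ ⟨s, hs, rfl⟩
    rw [← map_mul, ← map_mul, hy s hs]

/-- The von Neumann algebra `w N w* = {w x w* : x ∈ N}`, for a unitary operator `w`. -/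
def conj (w : unitary (H →L[ℂ] H)) (N : VonNeumannAlgebra H) : VonNeumannAlgebra H where
  toStarSubalgebra :=
    N.toStarSubalgebra.map (Unitary.conjStarAlgAut ℂ (H →L[ℂ] H) w).toStarAlgHom
  centralizer_centralizer' := by
    have h : ∀ S : Set (H →L[ℂ] H), Set.centralizer
        ((Unitary.conjStarAlgAut ℂ (H →L[ℂ] H) w) '' S) =
        (Unitary.conjStarAlgAut ℂ (H →L[ℂ] H) w) '' Set.centralizer S := fun S =>
      centralizer_image_mulEquiv (Unitary.conjStarAlgAut ℂ (H →L[ℂ] H) w : _ ≃* _) S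
    change Set.centralizer (Set.centralizer
      ((Unitary.conjStarAlgAut ℂ (H →L[ℂ] H) w) '' (N : Set (H →L[ℂ] H)))) =
      (Unitary.conjStarAlgAut ℂ (H →L[ℂ] H) w) '' (N : Set (H →L[ℂ] H))
    rw [h, h, VonNeumannAlgebra.centralizer_centralizer]

theorem mem_conj {w : unitary (H →L[ℂ] H)} {N : VonNeumannAlgebra H} {x : H →L[ℂ] H} :
    x ∈ conj w N ↔ ∃ a ∈ N, (w : H →L[ℂ] H) * a * star (w : H →L[ℂ] H) = x :=
  Iff.rfl

variable {M : VonNeumannAlgebra H}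

/-- The norm `‖x‖₂ = τ(x* x)^{1/2}`. -/
def norm₂ (τ : M.toStarSubalgebra →ₗ[ℂ] ℂ) (x : M.toStarSubalgebra) : ℝ :=
  √(τ (star x * x)).re

/-- The norm `‖φ‖_{∞,2} = sup {‖φ(x)‖₂ : ‖x‖ ≤ 1}` of a map `φ : M → M`, with the operator norm on
the domain and the norm `‖·‖₂` on the range. -/
def normInfTwo (τ : M.toStarSubalgebra →ₗ[ℂ] ℂ)
    (φ : M.toStarSubalgebra → M.toStarSubalgebra) : ℝ :=
  sSup {r | ∃ x : M.toStarSubalgebra, ‖(x : H →L[ℂ] H)‖ ≤ 1 ∧ r = norm₂ τ (φ x)}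

/-- `y` is the value at `x` of the `τ`-preserving conditional expectation of `M` onto `N`:
`y ∈ N` and `τ(y b) = τ(x b)` for all `b ∈ N`. -/
def IsExpectation (τ : M.toStarSubalgebra →ₗ[ℂ] ℂ) (N : VonNeumannAlgebra H)
    (x y : M.toStarSubalgebra) : Prop :=
  (y : H →L[ℂ] H) ∈ N ∧
    ∀ b : M.toStarSubalgebra, (b : H →L[ℂ] H) ∈ N → τ (y * b) = τ (x * b)

theorem IsExpectation.unique {τ : M.toStarSubalgebra →ₗ[ℂ] ℂ} (hτ : IsNormalizedTrace τ)
    {N : VonNeumannAlgebra H} {x y z : M.toStarSubalgebra}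
    (hy : IsExpectation τ N x y) (hz : IsExpectation τ N x z) : y = z := by
  have hmem : ((star (y - z) : M.toStarSubalgebra) : H →L[ℂ] H) ∈ N :=
    star_mem (sub_mem hy.1 hz.1)
  refine sub_eq_zero.1 (hτ.faithful _ ?_)
  rw [hτ.tracial, sub_mul, map_sub, hy.2 _ hmem, hz.2 _ hmem, sub_self]

open Classical in
/-- The trace preserving conditional expectation `E_N : M → N ⊆ M` onto a von Neumann subalgebra `N`
of `M`. When `τ` is a faithful normal tracial state, the element chosen here always exists (a
standard fact) and is unique, so that the default value `0` is not used. -/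
def condExp (τ : M.toStarSubalgebra →ₗ[ℂ] ℂ) (N : VonNeumannAlgebra H)
    (x : M.toStarSubalgebra) : M.toStarSubalgebra :=
  if h : ∃ y, IsExpectation τ N x y then h.choose else 0

/-- The inequality `‖E_{uAu*} - E_A‖_{∞,2} ≥ c ‖u - E_A(u)‖₂` for all unitaries `u` of `M`. -/
def IsAlphaStronglySingular (τ : M.toStarSubalgebra →ₗ[ℂ] ℂ) (A : VonNeumannAlgebra H)
    (c : ℝ) : Prop :=
  ∀ (u : unitary (H →L[ℂ] H)) (hu : (u : H →L[ℂ] H) ∈ M.toStarSubalgebra),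
    c * norm₂ τ (⟨u, hu⟩ - condExp τ A ⟨u, hu⟩) ≤
      normInfTwo τ (fun x => condExp τ (conj u A) x - condExp τ A x)

/-- Strong singularity is `1`-strong singularity. -/
def IsStronglySingular (τ : M.toStarSubalgebra →ₗ[ℂ] ℂ) (A : VonNeumannAlgebra H) : Prop :=
  IsAlphaStronglySingular τ A 1

/-- The invariant `α(A)`: the supremum of all real `c` for which `A` is `c`-strongly singular. The
supremum is taken in the extended reals, so that no convention for unbounded sets enters. -/
def alpha (τ : M.toStarSubalgebra →ₗ[ℂ] ℂ) (A : VonNeumannAlgebra H) : EReal :=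
  sSup ((fun c : ℝ => (c : EReal)) '' {c | IsAlphaStronglySingular τ A c})

/-- `v` is a non-zero partial isometry such that `v v*` and `v* v` are orthogonal projections
lying in `A`. -/
structure IsPopaIsometry (A : VonNeumannAlgebra H) (v : M.toStarSubalgebra) : Prop where
  ne_zero : v ≠ 0
  final : IsStarProjection (v * star v)
  initial : IsStarProjection (star v * v)
  final_mem : ((v * star v : M.toStarSubalgebra) : H →L[ℂ] H) ∈ A
  initial_mem : ((star v * v : M.toStarSubalgebra) : H →L[ℂ] H) ∈ A
  orthogonal : v * star v * (star v * v) = 0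

/-- `δ(vAv*, A) = sup {‖x - E_A(x)‖₂ : x ∈ vAv*, ‖x‖ ≤ 1}`. -/
def deltaAt (τ : M.toStarSubalgebra →ₗ[ℂ] ℂ) (A : VonNeumannAlgebra H)
    (v : M.toStarSubalgebra) : ℝ :=
  sSup {r | ∃ x : M.toStarSubalgebra,
    (∃ a : M.toStarSubalgebra, (a : H →L[ℂ] H) ∈ A ∧ x = v * a * star v) ∧
    ‖(x : H →L[ℂ] H)‖ ≤ 1 ∧ r = norm₂ τ (x - condExp τ A x)}

/-- Popa's invariant `δ(A)`: the largest `c` such that `δ(vAv*, A) ≥ c ‖v* v‖₂` for every non-zero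
partial isometry `v ∈ M` whose initial and final projections are orthogonal projections in `A`.
As for `α(A)`, the supremum is taken in the extended reals. -/
def delta (τ : M.toStarSubalgebra →ₗ[ℂ] ℂ) (A : VonNeumannAlgebra H) : EReal :=
  sSup ((fun c : ℝ => (c : EReal)) ''
    {c | ∀ v : M.toStarSubalgebra, IsPopaIsometry A v →
      c * norm₂ τ (star v * v) ≤ deltaAt τ A v})

end IIOne

end

open Filter Topology
open scoped ComplexOrder InnerProductSpace

noncomputable section

namespace IIOne

universe u

variable {H : Type u} [NormedAddCommGroup H] [InnerProductSpace ℂ H] [CompleteSpace H]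
variable {M : VonNeumannAlgebra H}

/-! ### The trace and the norm `‖·‖₂` -/

/-! Fix a partial isometry `v` as in the definition of δ, with orthogonal projections q = vv* and p
= v*v in A, and put δ = δ(vAv*, A). Test strong singularity on the self-adjoint unitary u = v + v* +
(1 - q - p). Since E_A(v) = 0, ‖u - E_A(u)‖₂ = √2 ‖p‖₂, so it suffices to show ‖E_{uAu*} -
E_A‖_{∞,2} ≤ √10 δ; the factors √2 then cancel and leave √5.

For ‖x‖ ≤ 1 let f = E_A(uxu) and D = E_{uAu*}(x) - E_A(x) = ufu - E_A(x). As u fixes r = 1 - q - p,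
rD = 0. The pieces qD and pD are orthogonal, and conjugation by u turns pD, up to sign, into the
piece qD for uxu. So everything rests on ‖qD‖₂² ≤ 5δ² (`norm₂_final_mul_sub_sq_le`).

With b = vfv*, qD = (b - E_A(b)) + a, where a = E_A(b - qx), and the summands are orthogonal. The
first has norm at most δ. For the second, f obeys every half-space bound Re τ(c ·) ≤ r valid at all
conjugates w(uxu)w* with w a unitary of A (`condExp_mem_averageSet`). After this replacement, ‖a‖₂²
becomes Re τ(a*(gy - yg)) with g = vwv* and ‖y‖ ≤ 1. Because E_A(g) commutes with a*, this is at
most 2‖a‖₂ ‖g - E_A(g)‖₂ ≤ 2δ‖a‖₂ (`re_trace_commutator_le`). Hence ‖a‖₂ ≤ 2δ, and 1 + 4 = 5.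

The expectation itself is obtained by minimising ‖·‖₂ over the averages of x, using weak compactness
of the unit ball. -/

theorem isClosed_coe (N : VonNeumannAlgebra H) :
    IsClosed (N.toStarSubalgebra : Set (H →L[ℂ] H)) := by
  rw [VonNeumannAlgebra.coe_toStarSubalgebra, ← N.centralizer_centralizer]
  exact Set.isClosed_centralizer _

/-- This gives h*h - (yh)*(yh) = (kh)*(kh), so that ‖yh‖₂ ≤ ‖h‖₂ follows from positivity of τ on
elements z*z. -/
theorem exists_one_sub_star_mul_self {R : Type*} [CStarAlgebra R] {y : R} (hy : ‖y‖ ≤ 1) :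
    ∃ k : R, 1 - star y * y = star k * k := by
  let _ := CStarAlgebra.spectralOrder R
  have _ := CStarAlgebra.spectralOrderedRing R
  have h := CStarAlgebra.star_mul_le_algebraMap_norm_sq (a := y)
  have h1 : algebraMap ℝ R (‖y‖ ^ 2) ≤ 1 := by
    rw [← map_one (algebraMap ℝ R)]
    exact algebraMap_mono R (by nlinarith [norm_nonneg y])
  exact CStarAlgebra.nonneg_iff_eq_star_mul_self.1 (sub_nonneg.2 (h.trans h1))

namespace IsNormalizedTrace

variable {τ : M.toStarSubalgebra →ₗ[ℂ] ℂ} (hτ : IsNormalizedTrace τ)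
include hτ

/-- The trace of (1 + iz)*(1 + iz) = 1 + iz - iz* + z*z is real, and its imaginary part is Re τ(z) -
Re τ(z*). -/
theorem re_star (z : M.toStarSubalgebra) : (τ (star z)).re = (τ z).re := by
  have h := (Complex.nonneg_iff.1 (hτ.nonneg (1 + Complex.I • z))).2
  have h2 := (Complex.nonneg_iff.1 (hτ.nonneg z)).2
  have e : star (1 + Complex.I • z) * (1 + Complex.I • z) =
      1 + Complex.I • z - Complex.I • star z + star z * z := by
    simp only [star_add, star_one, star_smul, Complex.star_def, Complex.conj_I, add_mul, mul_add,
      one_mul, mul_one, smul_mul_smul_comm]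
    simp
    abel
  rw [e] at h
  simp [hτ.map_one] at h
  linarith

theorem norm₂_sq (x : M.toStarSubalgebra) : norm₂ τ x ^ 2 = (τ (star x * x)).re :=
  Real.sq_sqrt (Complex.nonneg_iff.1 (hτ.nonneg x)).1

omit hτ in
theorem norm₂_nonneg (x : M.toStarSubalgebra) : 0 ≤ norm₂ τ x := Real.sqrt_nonneg _

theorem re_star_mul_comm (x y : M.toStarSubalgebra) :
    (τ (star y * x)).re = (τ (star x * y)).re := by
  rw [← hτ.re_star, star_mul, star_star]

theorem eq_zero_of_norm₂ {x : M.toStarSubalgebra} (h : norm₂ τ x ≤ 0) : x = 0 := by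
  refine hτ.faithful x (Complex.ext ?_ (Complex.nonneg_iff.1 (hτ.nonneg x)).2.symm)
  rw [← hτ.norm₂_sq, le_antisymm h (norm₂_nonneg x)]
  simp

theorem norm₂_add_sq (x y : M.toStarSubalgebra) :
    norm₂ τ (x + y) ^ 2 = norm₂ τ x ^ 2 + 2 * (τ (star x * y)).re + norm₂ τ y ^ 2 := by
  simp only [hτ.norm₂_sq, star_add, add_mul, mul_add, map_add, Complex.add_re,
    hτ.re_star_mul_comm x y]
  ring

omit hτ in
theorem norm₂_neg (x : M.toStarSubalgebra) : norm₂ τ (-x) = norm₂ τ x := by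
  simp [norm₂]

theorem norm₂_sub_sq (x y : M.toStarSubalgebra) :
    norm₂ τ (x - y) ^ 2 = norm₂ τ x ^ 2 - 2 * (τ (star x * y)).re + norm₂ τ y ^ 2 := by
  rw [sub_eq_add_neg, hτ.norm₂_add_sq, norm₂_neg]
  simp
  ring

omit hτ in
theorem norm₂_smul (t : ℝ) (x : M.toStarSubalgebra) :
    norm₂ τ ((t : ℂ) • x) = |t| * norm₂ τ x := by
  have : (τ (star ((t : ℂ) • x) * ((t : ℂ) • x))).re = t ^ 2 * (τ (star x * x)).re := by
    rw [star_smul, smul_mul_smul_comm, map_smul, smul_eq_mul]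
    simp [pow_two]
  rw [norm₂, this, Real.sqrt_mul (sq_nonneg _), Real.sqrt_sq_eq_abs, norm₂]

/-- Cauchy–Schwarz, from expanding the square of the norm of ‖y‖₂ x - ‖x‖₂ y. -/
theorem re_star_mul_le (x y : M.toStarSubalgebra) :
    (τ (star x * y)).re ≤ norm₂ τ x * norm₂ τ y := by
  by_cases hx : norm₂ τ x = 0
  · rw [hτ.eq_zero_of_norm₂ hx.le]
    simp [norm₂]
  by_cases hy : norm₂ τ y = 0
  · rw [hτ.eq_zero_of_norm₂ hy.le]
    simp [norm₂]
  have hx' := (norm₂_nonneg x).lt_of_ne' hx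
  have hy' := (norm₂_nonneg y).lt_of_ne' hy
  have h := hτ.norm₂_sub_sq ((norm₂ τ y : ℂ) • x) ((norm₂ τ x : ℂ) • y)
  have e : (τ (star ((norm₂ τ y : ℂ) • x) * ((norm₂ τ x : ℂ) • y))).re =
      norm₂ τ x * norm₂ τ y * (τ (star x * y)).re := by
    rw [star_smul, smul_mul_smul_comm, map_smul, smul_eq_mul, Complex.star_def,
      Complex.conj_ofReal, ← Complex.ofReal_mul, Complex.re_ofReal_mul]
    ring
  rw [e, norm₂_smul, norm₂_smul, abs_of_pos hx', abs_of_pos hy'] at h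
  have h0 : 0 ≤ 2 * (norm₂ τ x * norm₂ τ y) * (norm₂ τ x * norm₂ τ y - (τ (star x * y)).re) := by
    nlinarith [sq_nonneg (norm₂ τ ((norm₂ τ y : ℂ) • x - (norm₂ τ x : ℂ) • y))]
  have := nonneg_of_mul_nonneg_right h0 (by positivity)
  linarith

theorem norm₂_star (x : M.toStarSubalgebra) : norm₂ τ (star x) = norm₂ τ x := by
  rw [norm₂, norm₂, star_star, hτ.tracial]

theorem norm₂_mul_le {y : M.toStarSubalgebra} (hy : ‖y‖ ≤ 1) (h : M.toStarSubalgebra) :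
    norm₂ τ (y * h) ≤ norm₂ τ h := by
  have : IsClosed (M.toStarSubalgebra : Set (H →L[ℂ] H)) := isClosed_coe M
  obtain ⟨k, hk⟩ := exists_one_sub_star_mul_self (R := M.toStarSubalgebra) hy
  have e : star h * h - star (y * h) * (y * h) = star (k * h) * (k * h) := by
    calc _ = star h * (1 - star y * y) * h := by rw [star_mul]; noncomm_ring
      _ = _ := by rw [hk, star_mul]; noncomm_ring
  refine Real.sqrt_le_sqrt (sub_nonneg.1 ?_)
  rw [← Complex.sub_re, ← map_sub, e]
  exact (Complex.nonneg_iff.1 (hτ.nonneg _)).1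

theorem norm₂_mul_le' {y : M.toStarSubalgebra} (hy : ‖y‖ ≤ 1) (h : M.toStarSubalgebra) :
    norm₂ τ (h * y) ≤ norm₂ τ h := by
  rw [← hτ.norm₂_star, star_mul, ← hτ.norm₂_star h]
  exact hτ.norm₂_mul_le (by rwa [norm_star]) _

theorem norm₂_le_one {x : M.toStarSubalgebra} (hx : ‖x‖ ≤ 1) : norm₂ τ x ≤ 1 := by
  simpa [norm₂, hτ.map_one] using hτ.norm₂_mul_le hx 1

theorem norm₂_conj {w : M.toStarSubalgebra} (hw : w ∈ unitary M.toStarSubalgebra)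
    (x : M.toStarSubalgebra) : norm₂ τ (w * x * star w) = norm₂ τ x := by
  have : star (w * x * star w) * (w * x * star w) = w * (star x * x * star w) := by
    calc _ = w * star x * (star w * w) * x * star w := by
            simp only [star_mul, star_star, mul_assoc]
      _ = _ := by rw [Unitary.star_mul_self_of_mem hw]; noncomm_ring
  rw [norm₂, this, hτ.tracial, mul_assoc, Unitary.star_mul_self_of_mem hw, mul_one, norm₂]

/-- A normal trace is weakly continuous on bounded sets after multiplication by a fixed element. -/
theorem tendsto_mul {ι : Type*} {l : Filter ι} {f : ι → M.toStarSubalgebra}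
    {y : M.toStarSubalgebra} (hf : ∀ i, ‖f i‖ ≤ 1) (hy : ‖y‖ ≤ 1)
    (h : ∀ ξ η : H, Tendsto (fun i => ⟪ξ, (f i : H →L[ℂ] H) η⟫_ℂ) l
      (𝓝 ⟪ξ, (y : H →L[ℂ] H) η⟫_ℂ)) (c : M.toStarSubalgebra) :
    Tendsto (fun i => τ (c * f i)) l (𝓝 (τ (c * y))) := by
  -- Normality speaks only of the unit ball, so `c` is scaled into it and the factor is removed at
  -- the end.
  set t : ℝ := (‖c‖ + 1)⁻¹ with ht
  have ht0 : (t : ℂ) ≠ 0 := by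
    have : 0 < t := by positivity
    exact_mod_cast this.ne'
  have htc : ‖(t : ℂ) • c‖ ≤ 1 := by
    rw [norm_smul, Complex.norm_real, Real.norm_of_nonneg (by positivity), ht,
      inv_mul_le_iff₀ (by positivity)]
    linarith
  have hle : ∀ z : M.toStarSubalgebra, ‖z‖ ≤ 1 → ‖(t : ℂ) • c * z‖ ≤ 1 := fun z hz =>
    (norm_mul_le _ _).trans (mul_le_one₀ htc (norm_nonneg _) hz)
  have key := hτ.normal (l.map fun i => (t : ℂ) • c * f i) ((t : ℂ) • c * y)
    (eventually_map.2 (Eventually.of_forall fun i => hle _ (hf i))) (hle _ hy) (fun ξ η => by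
      rw [tendsto_map'_iff]
      have := h (star ((t : ℂ) • c : H →L[ℂ] H) ξ) η
      simp only [ContinuousLinearMap.star_eq_adjoint, ContinuousLinearMap.adjoint_inner_left]
        at this
      exact this)
  rw [tendsto_map'_iff] at key
  have := key.const_mul (t : ℂ)⁻¹
  simpa [Function.comp_def, ht0] using this

end IsNormalizedTrace

/-- Weak operator compactness of the unit ball, in terms of ultrafilters. -/
theorem exists_tendsto_inner {ι : Type*} (l : Ultrafilter ι) {f : ι → H →L[ℂ] H}
    (hf : ∀ i, ‖f i‖ ≤ 1) : ∃ T : H →L[ℂ] H, ‖T‖ ≤ 1 ∧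
      ∀ ξ η : H, Tendsto (fun i => ⟪ξ, f i η⟫_ℂ) l (𝓝 ⟪ξ, T η⟫_ℂ) := by
  have hb : ∀ ξ η i, ‖⟪f i ξ, η⟫_ℂ‖ ≤ 1 * ‖ξ‖ * ‖η‖ := fun ξ η i =>
    (norm_inner_le_norm _ _).trans (mul_le_mul_of_nonneg_right
      ((f i).le_of_opNorm_le (hf i) ξ) (norm_nonneg _))
  have hl : ∀ ξ η, ∃ z, ‖z‖ ≤ 1 * ‖ξ‖ * ‖η‖ ∧ Tendsto (fun i => ⟪f i ξ, η⟫_ℂ) l (𝓝 z) := by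
    intro ξ η
    obtain ⟨z, hz, h⟩ := (isCompact_closedBall (0 : ℂ) (1 * ‖ξ‖ * ‖η‖)).ultrafilter_le_nhds
      (l.map fun i => ⟪f i ξ, η⟫_ℂ) (le_principal_iff.2 (Ultrafilter.mem_map.2
        (univ_mem' fun i => by simpa using hb ξ η i)))
    exact ⟨z, by simpa using hz, h⟩
  choose B hB hlim using hl
  -- Uniqueness of limits makes `B` a sesquilinear form bounded by 1, which `T` then represents.
  let L : H →ₗ⋆[ℂ] H →ₗ[ℂ] ℂ := LinearMap.mk₂'ₛₗ _ _ B
    (fun a b c => tendsto_nhds_unique (hlim _ _)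
      (by simpa [inner_add_left] using (hlim a c).add (hlim b c)))
    (fun a b c => tendsto_nhds_unique (hlim _ _)
      (by simpa [inner_smul_left, mul_comm] using (hlim b c).const_mul (starRingEnd ℂ a)))
    (fun a b c => tendsto_nhds_unique (hlim _ _)
      (by simpa [inner_add_right] using (hlim a b).add (hlim a c)))
    (fun a b c => tendsto_nhds_unique (hlim _ _)
      (by simpa [inner_smul_right] using (hlim b c).const_mul a))
  let T := InnerProductSpace.continuousLinearMapOfBilin (L.mkContinuous₂ 1 hB)
  have hT : ∀ ξ η, ⟪T ξ, η⟫_ℂ = B ξ η := fun ξ η => by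
    simp only [T, InnerProductSpace.continuousLinearMapOfBilin_apply]
    rfl
  refine ⟨T, ContinuousLinearMap.opNorm_le_bound _ zero_le_one fun ξ => ?_, fun ξ η => ?_⟩
  · by_cases h0 : ‖T ξ‖ = 0
    · rw [h0]; positivity
    have h1 := hB ξ (T ξ)
    rw [← hT, inner_self_eq_norm_sq_to_K] at h1
    rw [norm_pow, RCLike.norm_ofReal, abs_norm, pow_two] at h1
    exact le_of_mul_le_mul_right h1 ((norm_nonneg _).lt_of_ne' h0)
  · have := (Complex.continuous_conj.tendsto _).comp (hlim η ξ)
    rw [← hT] at this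
    simpa [Function.comp_def, inner_conj_symm] using this

/-- A von Neumann algebra is closed in the weak operator topology. -/
theorem mem_of_tendsto_inner {N : VonNeumannAlgebra H} {ι : Type*} {l : Filter ι} [l.NeBot]
    {f : ι → H →L[ℂ] H} {T : H →L[ℂ] H} (hf : ∀ i, f i ∈ N)
    (h : ∀ ξ η : H, Tendsto (fun i => ⟪ξ, f i η⟫_ℂ) l (𝓝 ⟪ξ, T η⟫_ℂ)) : T ∈ N := by
  rw [← N.commutant_commutant, VonNeumannAlgebra.mem_commutant_iff]
  intro g hg
  rw [VonNeumannAlgebra.mem_commutant_iff] at hg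
  ext η
  refine ext_inner_left ℂ fun ξ => ?_
  refine tendsto_nhds_unique ?_ (h ξ (g η))
  have := h (star g ξ) η
  simp only [ContinuousLinearMap.star_eq_adjoint, ContinuousLinearMap.adjoint_inner_left] at this
  refine this.congr fun i => ?_
  rw [← mul_apply_eq_comp, ← hg _ (hf i), mul_apply_eq_comp]

/-! ### The conditional expectation onto a masa -/

namespace IsMasa

variable {A : VonNeumannAlgebra H} (hA : IsMasa M A)
include hA

theorem le {x : H →L[ℂ] H} (hx : x ∈ A) : x ∈ M := hA.prop.1 hx

theorem commute {x y : M.toStarSubalgebra} (hx : (x : H →L[ℂ] H) ∈ A)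
    (hy : (y : H →L[ℂ] H) ∈ A) : x * y = y * x :=
  Subtype.ext (hA.prop.2 _ hx _ hy)

/-- Adjoining `h` to A gives an abelian self-adjoint subalgebra of M, so maximality forces `h` into
A. Self-adjointness keeps the generating set closed under the star. -/
theorem mem_of_isSelfAdjoint {h : H →L[ℂ] H} (hM : h ∈ M) (hs : IsSelfAdjoint h)
    (hc : ∀ a ∈ A, a * h = h * a) : h ∈ A := by
  have hcomm : ∀ x ∈ insert h (A : Set (H →L[ℂ] H)), ∀ y ∈ insert h (A : Set (H →L[ℂ] H)),
      x * y = y * x := by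
    rintro x (rfl | hx) y (rfl | hy)
    · rfl
    · exact (hc y hy).symm
    · exact hc x hx
    · exact hA.prop.2 _ hx _ hy
  have hstar : ∀ x ∈ insert h (A : Set (H →L[ℂ] H)),
      star x ∈ insert h (A : Set (H →L[ℂ] H)) := by
    rintro x (rfl | hx)
    · exact Or.inl hs
    · exact Or.inr (star_mem (S := VonNeumannAlgebra H) hx)
  have hm := StarAlgebra.isMulCommutative_adjoin ℂ hcomm
    (fun x hx y hy => hcomm x hx _ (hstar y hy))
  refine hA.le_of_ge (y := StarAlgebra.adjoin ℂ (insert h (A : Set (H →L[ℂ] H))))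
    ⟨StarAlgebra.adjoin_le ?_, fun x hx y hy => ?_⟩
    (fun x hx => StarAlgebra.subset_adjoin ℂ _ (Or.inr hx))
    (StarAlgebra.subset_adjoin ℂ _ (Or.inl rfl))
  · rintro x (rfl | hx)
    · exact hM
    · exact hA.prop.1 hx
  · exact setLike_mul_comm hx hy

theorem mem_of_commute {y : H →L[ℂ] H} (hM : y ∈ M) (hc : ∀ a ∈ A, a * y = y * a) : y ∈ A := by
  have hc' : ∀ a ∈ A, a * star y = star y * a := fun a ha => by
    simpa using congrArg star (hc (star a) (star_mem ha)).symm
  have h1 : y + star y ∈ A := hA.mem_of_isSelfAdjoint (add_mem hM (star_mem hM))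
    (IsSelfAdjoint.add_star_self y) fun a ha => by rw [mul_add, add_mul, hc a ha, hc' a ha]
  have hI : ∀ N : VonNeumannAlgebra H, ∀ (c : ℂ), ∀ x ∈ N, c • x ∈ N := fun N c x hx =>
    N.toStarSubalgebra.smul_mem hx c
  have h2 : Complex.I • (y - star y) ∈ A := hA.mem_of_isSelfAdjoint
    (hI _ _ _ (sub_mem hM (star_mem hM)))
    (by simp [isSelfAdjoint_iff, ← smul_neg])
    fun a ha => by rw [mul_smul_comm, smul_mul_assoc, mul_sub, sub_mul, hc a ha, hc' a ha]
  have e : y = (1 / 2 : ℂ) • ((y + star y) + (-Complex.I) • (Complex.I • (y - star y))) := by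
    rw [smul_smul, neg_mul, Complex.I_mul_I, neg_neg, one_smul, add_add_sub_cancel, ← two_smul ℂ,
      smul_smul]
    norm_num
  rw [e]
  exact hI _ _ _ (add_mem h1 (hI _ _ _ h2))

/-- The hypothesis says that `y` commutes with the unitaries of A; these span A, so `y` commutes
with A and maximality applies. -/
theorem mem_of_unitary_conj {y : M.toStarSubalgebra}
    (h : ∀ w ∈ unitary M.toStarSubalgebra, (w : H →L[ℂ] H) ∈ A → w * y * star w = y) :
    (y : H →L[ℂ] H) ∈ A := by
  refine hA.mem_of_commute y.2 fun a ha => ?_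
  have : IsClosed (A.toStarSubalgebra : Set (H →L[ℂ] H)) := isClosed_coe A
  have hs := CStarAlgebra.span_unitary A.toStarSubalgebra
  have hmem : (⟨a, ha⟩ : A.toStarSubalgebra) ∈
      Submodule.span ℂ (unitary A.toStarSubalgebra : Set A.toStarSubalgebra) := by
    rw [hs]; trivial
  refine Submodule.span_induction (p := fun (x : A.toStarSubalgebra) _ =>
    (x : H →L[ℂ] H) * (y : H →L[ℂ] H) = y * x) ?_ ?_ ?_ ?_ hmem
  · intro w hw
    have h1 : star (w : H →L[ℂ] H) * w = 1 := congrArg Subtype.val (Unitary.star_mul_self_of_mem hw)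
    have h2 : (w : H →L[ℂ] H) * star (w : H →L[ℂ] H) = 1 :=
      congrArg Subtype.val (Unitary.mul_star_self_of_mem hw)
    have h3 : (w : H →L[ℂ] H) * y * star (w : H →L[ℂ] H) = y := congrArg Subtype.val
      (h ⟨w, hA.le w.2⟩ (Unitary.mem_iff.2 ⟨Subtype.ext h1, Subtype.ext h2⟩) w.2)
    conv_rhs => rw [← h3]
    rw [mul_assoc _ _ (w : H →L[ℂ] H), h1, mul_one]
  · simp
  · intro x z _ _ hx hz
    simp only [AddMemClass.coe_add, add_mul, mul_add, hx, hz]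
  · intro c x _ hx
    simp only [SetLike.val_smul, smul_mul_assoc, mul_smul_comm, hx]

end IsMasa

/-- The intersection of the unit ball with the closed half-spaces containing all `w x w*`, for
`w` a unitary of `A`. It contains the weakly closed convex hull of these elements. -/
def averageSet (τ : M.toStarSubalgebra →ₗ[ℂ] ℂ) (A : VonNeumannAlgebra H)
    (x : M.toStarSubalgebra) : Set M.toStarSubalgebra :=
  {k | ‖k‖ ≤ 1 ∧ ∀ (c : M.toStarSubalgebra) (r : ℝ),
    (∀ w ∈ unitary M.toStarSubalgebra, (w : H →L[ℂ] H) ∈ A →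
      (τ (c * (w * x * star w))).re ≤ r) → (τ (c * k)).re ≤ r}

/-! ### Existence of the expectation by minimising `‖·‖₂` over averages -/

section averageSet

variable {τ : M.toStarSubalgebra →ₗ[ℂ] ℂ} {A : VonNeumannAlgebra H} {x k l : M.toStarSubalgebra}

theorem self_mem_averageSet (hx : ‖x‖ ≤ 1) : x ∈ averageSet τ A x :=
  ⟨hx, fun c r h => by simpa using h 1 (one_mem _) (one_mem A)⟩

theorem midpoint_mem_averageSet (hk : k ∈ averageSet τ A x) (hl : l ∈ averageSet τ A x) :
    ((1 / 2 : ℝ) : ℂ) • (k + l) ∈ averageSet τ A x := by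
  refine ⟨?_, fun c r h => ?_⟩
  · rw [norm_smul, Complex.norm_real, Real.norm_of_nonneg (by norm_num)]
    linarith [norm_add_le k l, hk.1, hl.1]
  · rw [mul_smul_comm, map_smul, smul_eq_mul, Complex.re_ofReal_mul, mul_add, map_add,
      Complex.add_re]
    linarith [hk.2 c r h, hl.2 c r h]

/-- By traciality, conjugation by `w` moves onto the functional as c ↦ w*cw, and left translation by
`w` preserves the unitaries of A. -/
theorem conj_mem_averageSet (hτ : IsNormalizedTrace τ) (hk : k ∈ averageSet τ A x)
    {w : M.toStarSubalgebra} (hw : w ∈ unitary M.toStarSubalgebra)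
    (hwA : (w : H →L[ℂ] H) ∈ A) : w * k * star w ∈ averageSet τ A x := by
  have hn : ∀ z : M.toStarSubalgebra, ∀ c, τ (c * (w * z * star w)) = τ (star w * c * w * z) :=
    fun z c => by rw [← mul_assoc, hτ.tracial]; simp only [mul_assoc]
  refine ⟨?_, fun c r h => ?_⟩
  · have : IsClosed (M.toStarSubalgebra : Set (H →L[ℂ] H)) := isClosed_coe M
    rw [CStarRing.norm_mul_mem_unitary _ (Unitary.star_mem hw), CStarRing.norm_mem_unitary_mul _ hw]
    exact hk.1
  · rw [hn]
    refine hk.2 _ r fun w' hw' hwA' => ?_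
    rw [← hn]
    have := h (w * w') (mul_mem hw hw') (mul_mem hwA hwA')
    rw [star_mul] at this
    simpa only [mul_assoc] using this

/-- An element of least `‖·‖₂` in the average set is fixed by conjugation with unitaries of A, hence
lies in A; the half-space conditions then give the trace identity. -/
theorem exists_isExpectation_mem_averageSet (hτ : IsNormalizedTrace τ) (hA : IsMasa M A)
    (hx : ‖x‖ ≤ 1) : ∃ y ∈ averageSet τ A x, IsExpectation τ A x y := by
  set d := sInf (norm₂ τ '' averageSet τ A x) with hd
  have hbdd : BddBelow (norm₂ τ '' averageSet τ A x) :=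
    ⟨0, by rintro _ ⟨k, -, rfl⟩; exact IsNormalizedTrace.norm₂_nonneg k⟩
  have hdle : ∀ k ∈ averageSet τ A x, d ≤ norm₂ τ k := fun k hk => csInf_le hbdd ⟨k, hk, rfl⟩
  have hne : (averageSet τ A x).Nonempty := ⟨x, self_mem_averageSet hx⟩
  have hd0 : 0 ≤ d := le_csInf (hne.image _)
    (by rintro _ ⟨k, -, rfl⟩; exact IsNormalizedTrace.norm₂_nonneg k)
  have hex : ∀ n : ℕ, ∃ k ∈ averageSet τ A x, norm₂ τ k < d + 1 / ((n : ℝ) + 1) := fun n => by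
    obtain ⟨_, ⟨k, hk, rfl⟩, h⟩ := exists_lt_of_csInf_lt
      (hne.image (norm₂ τ))
      (lt_add_of_pos_right d (Nat.one_div_pos_of_nat (α := ℝ) (n := n)))
    exact ⟨k, hk, h⟩
  choose k hk hkd using hex
  obtain ⟨T, hT, hlim⟩ := exists_tendsto_inner (hyperfilter ℕ)
    (f := fun n => (k n : H →L[ℂ] H)) fun n => (hk n).1
  let y : M.toStarSubalgebra := ⟨T, mem_of_tendsto_inner (N := M) (fun n => (k n).2) hlim⟩
  have hre : ∀ c, Tendsto (fun n => (τ (c * k n)).re) (hyperfilter ℕ) (𝓝 (τ (c * y)).re) :=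
    fun c => (Complex.continuous_re.tendsto _).comp
      (hτ.tendsto_mul (y := y) (fun n => (hk n).1) hT hlim c)
  have hy : y ∈ averageSet τ A x :=
    ⟨hT, fun c r h => le_of_tendsto (hre c) (Eventually.of_forall fun n => (hk n).2 c r h)⟩
  -- Weak lower semicontinuity: ‖y‖₂² is the limit of Re τ(y* k_n), which is at most ‖y‖₂ (d +
  -- 1/(n+1)).
  have hyd : norm₂ τ y ≤ d := by
    by_contra! hlt
    have h1 : Tendsto (fun n : ℕ => norm₂ τ y * (d + 1 / ((n : ℝ) + 1))) (hyperfilter ℕ)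
        (𝓝 (norm₂ τ y * (d + 0))) :=
      ((tendsto_const_nhds.add tendsto_one_div_add_atTop_nhds_zero_nat).const_mul _).mono_left
        Nat.hyperfilter_le_atTop
    have h2 := le_of_tendsto_of_tendsto (hre (star y)) h1 (Eventually.of_forall fun n =>
      (hτ.re_star_mul_le y (k n)).trans (mul_le_mul_of_nonneg_left (hkd n).le
        (IsNormalizedTrace.norm₂_nonneg y)))
    rw [← hτ.norm₂_sq] at h2
    nlinarith
  refine ⟨y, hy, hA.mem_of_unitary_conj fun w hw hwA => ?_, fun b hb => ?_⟩
  -- The midpoint of `y` and wyw* has norm at least d, while both ends have norm at most d; the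
  -- parallelogram law makes them equal.
  · have h1 := hdle _ (midpoint_mem_averageSet (conj_mem_averageSet hτ hy hw hwA) hy)
    rw [IsNormalizedTrace.norm₂_smul, abs_of_pos (by norm_num)] at h1
    have h2 := hτ.norm₂_add_sq (w * y * star w) y
    have h3 := hτ.norm₂_sub_sq (w * y * star w) y
    rw [hτ.norm₂_conj hw] at h2 h3
    refine sub_eq_zero.1 (hτ.eq_zero_of_norm₂ ?_)
    have h4 : norm₂ τ (w * y * star w - y) ^ 2 ≤ 0 := by
      nlinarith [IsNormalizedTrace.norm₂_nonneg (τ := τ) y]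
    exact (pow_eq_zero_iff two_ne_zero).1 (le_antisymm h4 (sq_nonneg _)) |>.le
  -- For b in A the functional Re τ(b ·) is constant on the conjugates wxw*. Using b and -b yields
  -- equality of real parts, and ib handles the imaginary part.
  · have hle : ∀ b : M.toStarSubalgebra, (b : H →L[ℂ] H) ∈ A →
        (τ (b * y)).re ≤ (τ (b * x)).re := fun b hb => hy.2 b _ fun w hw hwA => by
      rw [hτ.tracial, mul_assoc, mul_assoc, hA.commute (star_mem hwA) hb, hτ.tracial]
      rw [← mul_assoc, mul_assoc, Unitary.star_mul_self_of_mem hw, mul_one, hτ.tracial]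
    have hneg : ∀ b : M.toStarSubalgebra, (b : H →L[ℂ] H) ∈ A →
        (τ (b * y)).re = (τ (b * x)).re := fun b hb => by
      refine le_antisymm (hle b hb) ?_
      simpa using hle (-b) (neg_mem hb)
    rw [hτ.tracial, hτ.tracial x]
    refine Complex.ext (hneg b hb) ?_
    simpa using hneg (Complex.I • b) (A.toStarSubalgebra.smul_mem hb _)

end averageSet

/-! ### Properties of the expectation onto A and its conjugates -/

section condExp

variable {τ : M.toStarSubalgebra →ₗ[ℂ] ℂ} (hτ : IsNormalizedTrace τ)
  {A : VonNeumannAlgebra H} (hA : IsMasa M A)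

theorem IsExpectation.condExp_eq {N : VonNeumannAlgebra H} {x y : M.toStarSubalgebra}
    (hτ : IsNormalizedTrace τ) (h : IsExpectation τ N x y) : condExp τ N x = y := by
  have hex : ∃ y, IsExpectation τ N x y := ⟨y, h⟩
  rw [condExp, dif_pos hex]
  exact hex.choose_spec.unique hτ h

include hτ hA

theorem condExp_mem_averageSet {x : M.toStarSubalgebra} (hx : ‖x‖ ≤ 1) :
    condExp τ A x ∈ averageSet τ A x := by
  obtain ⟨y, hy, h⟩ := exists_isExpectation_mem_averageSet hτ hA hx
  rwa [h.condExp_eq hτ]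

theorem isExpectation_condExp (x : M.toStarSubalgebra) : IsExpectation τ A x (condExp τ A x) := by
  suffices ∃ y, IsExpectation τ A x y by
    obtain ⟨y, h⟩ := this
    rwa [h.condExp_eq hτ]
  set t : ℝ := ‖x‖ + 1 with ht
  have ht0 : (t : ℂ) ≠ 0 := by
    have : 0 < t := by positivity
    exact_mod_cast this.ne'
  have hx : ‖((t⁻¹ : ℝ) : ℂ) • x‖ ≤ 1 := by
    rw [norm_smul, Complex.norm_real, Real.norm_of_nonneg (by positivity), ht,
      inv_mul_le_iff₀ (by positivity)]
    linarith
  obtain ⟨y, -, h1, h2⟩ := exists_isExpectation_mem_averageSet hτ hA hx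
  refine ⟨(t : ℂ) • y, A.toStarSubalgebra.smul_mem h1 _, fun b hb => ?_⟩
  rw [smul_mul_assoc, map_smul, h2 b hb, smul_mul_assoc, map_smul, smul_smul]
  simp [ht0]

theorem condExp_mem (x : M.toStarSubalgebra) : (condExp τ A x : H →L[ℂ] H) ∈ A :=
  (isExpectation_condExp hτ hA x).1

theorem trace_condExp_mul (x : M.toStarSubalgebra) {b : M.toStarSubalgebra}
    (hb : (b : H →L[ℂ] H) ∈ A) : τ (condExp τ A x * b) = τ (x * b) :=
  (isExpectation_condExp hτ hA x).2 b hb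

omit hA in
theorem condExp_of_mem {a : M.toStarSubalgebra} (ha : (a : H →L[ℂ] H) ∈ A) :
    condExp τ A a = a :=
  IsExpectation.condExp_eq hτ ⟨ha, fun _ _ => rfl⟩

theorem condExp_sub (x y : M.toStarSubalgebra) :
    condExp τ A (x - y) = condExp τ A x - condExp τ A y :=
  IsExpectation.condExp_eq hτ ⟨sub_mem (condExp_mem hτ hA x) (condExp_mem hτ hA y),
    fun b hb => by rw [sub_mul, sub_mul, map_sub, map_sub, trace_condExp_mul hτ hA x hb,
      trace_condExp_mul hτ hA y hb]⟩

theorem condExp_add (x y : M.toStarSubalgebra) :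
    condExp τ A (x + y) = condExp τ A x + condExp τ A y :=
  IsExpectation.condExp_eq hτ ⟨add_mem (condExp_mem hτ hA x) (condExp_mem hτ hA y),
    fun b hb => by rw [add_mul, add_mul, map_add, map_add, trace_condExp_mul hτ hA x hb,
      trace_condExp_mul hτ hA y hb]⟩

theorem condExp_mul_right (x : M.toStarSubalgebra) {a : M.toStarSubalgebra}
    (ha : (a : H →L[ℂ] H) ∈ A) : condExp τ A (x * a) = condExp τ A x * a :=
  IsExpectation.condExp_eq hτ ⟨mul_mem (condExp_mem hτ hA x) ha, fun b hb => by
    rw [mul_assoc, mul_assoc, trace_condExp_mul hτ hA x (mul_mem ha hb)]⟩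

theorem condExp_mul_left (x : M.toStarSubalgebra) {a : M.toStarSubalgebra}
    (ha : (a : H →L[ℂ] H) ∈ A) : condExp τ A (a * x) = a * condExp τ A x :=
  IsExpectation.condExp_eq hτ ⟨mul_mem ha (condExp_mem hτ hA x), fun b hb => by
    rw [hτ.tracial, ← mul_assoc, hτ.tracial, trace_condExp_mul hτ hA x (mul_mem hb ha),
      hτ.tracial (a * x), ← mul_assoc b a x, hτ.tracial (b * a)]⟩

/-- Pythagoras: x - E_A(x) is orthogonal to A for the inner product of τ. -/
theorem norm₂_sub_condExp_add_sq (x : M.toStarSubalgebra) {a : M.toStarSubalgebra}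
    (ha : (a : H →L[ℂ] H) ∈ A) :
    norm₂ τ (x - condExp τ A x + a) ^ 2 = norm₂ τ (x - condExp τ A x) ^ 2 + norm₂ τ a ^ 2 := by
  have hsa : ((star a : M.toStarSubalgebra) : H →L[ℂ] H) ∈ A := star_mem ha
  rw [hτ.norm₂_add_sq, ← hτ.re_star_mul_comm, hτ.tracial, sub_mul, map_sub,
    trace_condExp_mul hτ hA x hsa, sub_self]
  simp

theorem norm₂_sub_condExp_le (x : M.toStarSubalgebra) :
    norm₂ τ (x - condExp τ A x) ≤ norm₂ τ x := by
  have h := norm₂_sub_condExp_add_sq hτ hA x (condExp_mem hτ hA x)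
  rw [sub_add_cancel] at h
  exact abs_le_of_sq_le_sq' (by nlinarith) (IsNormalizedTrace.norm₂_nonneg _) |>.2

/-- Reduces the expectation onto uAu* to the one onto A; it also shows that the former exists. -/
theorem condExp_conj (u : unitary (H →L[ℂ] H)) {w : M.toStarSubalgebra}
    (hw : (w : H →L[ℂ] H) = u) (x : M.toStarSubalgebra) :
    condExp τ (conj u A) x = w * condExp τ A (star w * x * w) * star w := by
  have hu : star w * w = 1 := Subtype.ext (by simp [hw])
  refine IsExpectation.condExp_eq hτ ⟨mem_conj.2 ⟨_, condExp_mem hτ hA (star w * x * w), ?_⟩,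
    fun b hb => ?_⟩
  · simp [hw]
  · obtain ⟨a, ha, hab⟩ := mem_conj.1 hb
    let a' : M.toStarSubalgebra := ⟨a, hA.le ha⟩
    have hb' : b = w * a' * star w := Subtype.ext (by simp [a', hw, hab])
    calc τ (w * condExp τ A (star w * x * w) * star w * b)
        = τ (w * (condExp τ A (star w * x * w) * (star w * w) * a' * star w)) := by
          rw [hb']; simp only [mul_assoc]
      _ = τ (condExp τ A (star w * x * w) * a' * (star w * w)) := by
          rw [hu, hτ.tracial]; simp only [mul_assoc, mul_one, hu]
      _ = τ (star w * x * w * a') := by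
          rw [hu, mul_one, trace_condExp_mul hτ hA _ ha]
      _ = τ (x * b) := by
          rw [hb', mul_assoc, mul_assoc, hτ.tracial]; simp only [mul_assoc]

end condExp

/-! ### The self-adjoint unitary swapping two orthogonal projections -/

section swap

variable {R : Type*} [Ring R] [StarRing R] {v : R}

/-- The self-adjoint unitary extending a partial isometry `v` with `v² = 0`. -/
def swap (v : R) : R := v + star v + (1 - v * star v - star v * v)

theorem star_swap (v : R) : star (swap v) = swap v := by
  simp only [swap, star_add, star_sub, star_mul, star_star, star_one]
  abel

variable (h₁ : v * star v * v = v) (h₂ : v * v = 0)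
include h₁

theorem star_mul_mul_star : star v * v * star v = star v := by
  simpa [mul_assoc] using congrArg star h₁

omit h₁ in
include h₂ in
theorem star_mul_star : star v * star v = 0 := by
  simpa using congrArg star h₂

include h₂

theorem swap_mul_self : swap v * swap v = 1 := by
  have h₃ := star_mul_mul_star h₁
  have h₄ := star_mul_star h₂
  have a2 : ∀ z, v * (v * z) = 0 := fun z => by rw [← mul_assoc, h₂, zero_mul]
  have a3 : ∀ z, star v * (star v * z) = 0 := fun z => by rw [← mul_assoc, h₄, zero_mul]
  rw [mul_assoc] at h₁ h₃
  simp only [swap, mul_add, add_mul, mul_sub, sub_mul, mul_assoc, h₁, h₂, h₃, h₄, a2, a3,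
    mul_one, one_mul, mul_zero]
  abel

theorem final_mul_swap : v * star v * swap v = v := by
  have h₃ := star_mul_mul_star h₁
  have h₄ := star_mul_star h₂
  have a3 : ∀ z, star v * (star v * z) = 0 := fun z => by rw [← mul_assoc, h₄, zero_mul]
  rw [mul_assoc] at h₁ h₃
  simp only [swap, mul_add, mul_sub, mul_assoc, h₁, h₃, h₄, a3, mul_one, mul_zero]
  abel

theorem initial_mul_swap : star v * v * swap v = star v := by
  have a2 : ∀ z, v * (v * z) = 0 := fun z => by rw [← mul_assoc, h₂, zero_mul]
  have h₃ := star_mul_mul_star h₁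
  rw [mul_assoc] at h₁ h₃
  simp only [swap, mul_add, mul_sub, mul_assoc, h₁, h₂, h₃, a2, mul_one, mul_zero]
  abel

theorem swap_mul_final : swap v * (v * star v) = star v := by
  simpa [star_swap, mul_assoc] using congrArg star (final_mul_swap h₁ h₂)

theorem swap_mul_initial : swap v * (star v * v) = v := by
  simpa [star_swap, mul_assoc] using congrArg star (initial_mul_swap h₁ h₂)

theorem swap_mul_fixed :
    swap v * (1 - v * star v - star v * v) = 1 - v * star v - star v * v := by
  rw [mul_sub, mul_sub, swap_mul_final h₁ h₂, swap_mul_initial h₁ h₂, swap]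
  simp only [mul_one]
  abel

theorem fixed_mul_swap :
    (1 - v * star v - star v * v) * swap v = 1 - v * star v - star v * v := by
  rw [sub_mul, sub_mul, final_mul_swap h₁ h₂, initial_mul_swap h₁ h₂, swap]
  simp only [one_mul]
  abel

end swap

theorem norm_le_one_of_mem_unitary {R : Type*} [NormedRing R] [StarRing R] [CStarRing R] {w : R}
    (hw : w ∈ unitary R) : ‖w‖ ≤ 1 := by
  nontriviality R
  exact (CStarRing.norm_of_mem_unitary hw).le

/-! ### Algebra of the partial isometries in the definition of δ -/

namespace IsPopaIsometry

variable {A : VonNeumannAlgebra H} {v : M.toStarSubalgebra} (hv : IsPopaIsometry A v)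
include hv

/-- With p = v*v idempotent, (vv*v - v)*(vv*v - v) = p³ - 2p² + p = 0. -/
theorem mul_star_mul : v * star v * v = v := by
  have hp := hv.initial.isIdempotentElem.eq
  have h : star (v * star v * v - v) * (v * star v * v - v) = 0 := by
    calc _ = star v * v * (star v * v) * (star v * v) - star v * v * (star v * v)
            - star v * v * (star v * v) + star v * v := by
          simp only [star_sub, star_mul, star_star]; noncomm_ring
      _ = 0 := by rw [hp, hp]; abel
  exact sub_eq_zero.1 (CStarRing.star_mul_self_eq_zero_iff _ |>.1 h)

theorem mul_self : v * v = 0 := by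
  have h := congrArg star hv.orthogonal
  rw [star_mul, hv.final.isSelfAdjoint.star_eq, hv.initial.isSelfAdjoint.star_eq, star_zero] at h
  calc v * v = v * star v * v * (v * star v * v) := by rw [hv.mul_star_mul]
    _ = v * (star v * v * (v * star v)) * v := by simp only [mul_assoc]
    _ = 0 := by rw [h]; simp

theorem swap_mem_unitary : swap v ∈ unitary M.toStarSubalgebra := by
  rw [Unitary.mem_iff, star_swap, swap_mul_self hv.mul_star_mul hv.mul_self, and_self]

theorem norm_le_one : ‖v‖ ≤ 1 := by
  have h := IsStarProjection.norm_le _ hv.initial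
  rw [CStarRing.norm_star_mul_self] at h
  by_contra! hlt
  nlinarith

theorem norm₂_sq_eq {τ : M.toStarSubalgebra →ₗ[ℂ] ℂ} (hτ : IsNormalizedTrace τ) :
    norm₂ τ v ^ 2 = norm₂ τ (star v * v) ^ 2 := by
  rw [hτ.norm₂_sq, hτ.norm₂_sq, hv.initial.isSelfAdjoint.star_eq,
    hv.initial.isIdempotentElem.eq]

end IsPopaIsometry

/-! ### Comparing `‖E_{uAu*} - E_A‖_{∞,2}` with `δ(vAv*, A)` -/

section estimate

variable {τ : M.toStarSubalgebra →ₗ[ℂ] ℂ} (hτ : IsNormalizedTrace τ)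
  {A : VonNeumannAlgebra H} (hA : IsMasa M A)

theorem deltaAt_nonneg (v : M.toStarSubalgebra) : 0 ≤ deltaAt τ A v :=
  Real.sSup_nonneg fun _ ⟨_, _, _, hr⟩ => hr ▸ IsNormalizedTrace.norm₂_nonneg _

include hτ hA

theorem norm₂_sub_condExp_le_deltaAt {v a : M.toStarSubalgebra} (ha : (a : H →L[ℂ] H) ∈ A)
    (h : ‖v * a * star v‖ ≤ 1) :
    norm₂ τ (v * a * star v - condExp τ A (v * a * star v)) ≤ deltaAt τ A v := by
  -- The real supremum dominates its members only because the set is bounded, here by ‖x - E_A(x)‖₂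
  -- ≤ ‖x‖₂ ≤ 1.
  refine le_csSup ⟨1, ?_⟩ ⟨_, ⟨a, ha, rfl⟩, h, rfl⟩
  rintro _ ⟨x, -, hx, rfl⟩
  exact (norm₂_sub_condExp_le hτ hA x).trans (hτ.norm₂_le_one hx)

/-- Since E_A(g) commutes with a*, its commutator with `y` has trace zero against a*. So `g` may be
replaced by g - E_A(g), and each of the two products contributes one Cauchy–Schwarz bound. -/
theorem re_trace_commutator_le {a y : M.toStarSubalgebra} (ha : (a : H →L[ℂ] H) ∈ A)
    (hy : ‖y‖ ≤ 1) (g : M.toStarSubalgebra) :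
    (τ (star a * (g * y))).re - (τ (star a * (y * g))).re ≤
      2 * norm₂ τ a * norm₂ τ (g - condExp τ A g) := by
  set e := condExp τ A g with he
  have hsa : ((star a : M.toStarSubalgebra) : H →L[ℂ] H) ∈ A := star_mem ha
  have hc : τ (star a * (e * y)) = τ (star a * (y * e)) := by
    rw [← mul_assoc, hA.commute hsa (condExp_mem hτ hA g), mul_assoc, hτ.tracial, ← mul_assoc]
  have h1 := hτ.re_star_mul_le a ((g - e) * y)
  have h2 := hτ.re_star_mul_le a (-(y * (g - e)))
  rw [IsNormalizedTrace.norm₂_neg] at h2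
  have h3 := mul_le_mul_of_nonneg_left (hτ.norm₂_mul_le' hy (g - e))
    (IsNormalizedTrace.norm₂_nonneg (τ := τ) a)
  have h4 := mul_le_mul_of_nonneg_left (hτ.norm₂_mul_le hy (g - e))
    (IsNormalizedTrace.norm₂_nonneg (τ := τ) a)
  simp only [sub_mul, mul_sub, mul_neg, map_sub, map_neg, Complex.sub_re, Complex.neg_re, hc]
    at h1 h2 h3 h4 ⊢
  linarith

variable {v : M.toStarSubalgebra} (hv : IsPopaIsometry A v)
include hv

omit hτ hA in
theorem norm_swap_conj {x : M.toStarSubalgebra} (hx : ‖x‖ ≤ 1) :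
    ‖swap v * x * swap v‖ ≤ 1 := by
  rwa [CStarRing.norm_mul_mem_unitary _ hv.swap_mem_unitary,
    CStarRing.norm_mem_unitary_mul _ hv.swap_mem_unitary]

omit hτ hA in
theorem norm_compression {a : M.toStarSubalgebra} (ha : ‖a‖ ≤ 1) : ‖v * a * star v‖ ≤ 1 :=
  (norm_mul_le _ _).trans (mul_le_one₀ ((norm_mul_le _ _).trans
    (mul_le_one₀ hv.norm_le_one (norm_nonneg _) ha)) (norm_nonneg _)
    (by rw [norm_star]; exact hv.norm_le_one))

omit hτ in
-- Cutting uAu* down by q = vv* gives vAv*, because v*v commutes with A.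
theorem final_mul_swap_conj {a : M.toStarSubalgebra} (ha : (a : H →L[ℂ] H) ∈ A) :
    v * star v * (swap v * a * swap v) = v * a * star v := by
  have h₁ := hv.mul_star_mul
  have h₂ := hv.mul_self
  calc _ = v * star v * swap v * a * swap v := by simp only [mul_assoc]
    _ = v * (star v * v) * a * swap v := by rw [final_mul_swap h₁ h₂, ← mul_assoc, h₁]
    _ = v * (star v * v * a) * swap v := by simp only [mul_assoc]
    _ = v * a * (star v * v * swap v) := by
      rw [hA.commute hv.initial_mem ha]; simp only [mul_assoc]
    _ = v * a * star v := by rw [initial_mul_swap h₁ h₂]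

omit hτ in
theorem swap_conj_mul_final {a : M.toStarSubalgebra} (ha : (a : H →L[ℂ] H) ∈ A) :
    swap v * a * swap v * (v * star v) = v * a * star v := by
  have hsa : ((star a : M.toStarSubalgebra) : H →L[ℂ] H) ∈ A := star_mem ha
  simpa [star_swap, mul_assoc] using congrArg star (final_mul_swap_conj hA hv hsa)

theorem norm₂_final_mul_sub_sq_le {x : M.toStarSubalgebra} (hx : ‖x‖ ≤ 1) :
    norm₂ τ (v * star v * (swap v * condExp τ A (swap v * x * swap v) * swap v - condExp τ A x)) ^ 2
      ≤ 5 * deltaAt τ A v ^ 2 := by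
  have h₁ := hv.mul_star_mul
  have h₂ := hv.mul_self
  have hu := swap_mul_self h₁ h₂
  set u := swap v with hu_def
  set q := v * star v with hq
  set δ := deltaAt τ A v
  set f := condExp τ A (u * x * u) with hf
  have hfA : (f : H →L[ℂ] H) ∈ A := condExp_mem hτ hA _
  have hfm := condExp_mem_averageSet hτ hA (norm_swap_conj hv hx)
  set b := v * f * star v with hb
  have hqf : q * (u * f * u) = b := final_mul_swap_conj hA hv hfA
  set a := condExp τ A (b - q * x) with ha
  have haA : (a : H →L[ℂ] H) ∈ A := condExp_mem hτ hA _
  have hsa : ((star a : M.toStarSubalgebra) : H →L[ℂ] H) ∈ A := star_mem haA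
  have e : q * (u * f * u - condExp τ A x) = b - condExp τ A b + a := by
    rw [mul_sub, hqf, ha, condExp_sub hτ hA, condExp_mul_left hτ hA x hv.final_mem]
    abel
  rw [e, norm₂_sub_condExp_add_sq hτ hA b haA]
  have hbδ : norm₂ τ (b - condExp τ A b) ≤ δ :=
    norm₂_sub_condExp_le_deltaAt hτ hA hfA (norm_compression hv hfm.1)
  have hδ : 0 ≤ δ := deltaAt_nonneg v
  have hb0 := IsNormalizedTrace.norm₂_nonneg (τ := τ) (b - condExp τ A b)
  have ha0 := IsNormalizedTrace.norm₂_nonneg (τ := τ) a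
  -- Bounds Re τ(a*b) through the conjugates of uxu whose averages produce `f`. The multiplier is
  -- chosen so that τ(u a* q u f) = τ(a*b).
  have key := hfm.2 (u * star a * q * u) (2 * norm₂ τ a * δ + (τ (star a * (q * x))).re) (by
    intro w hw hwA
    have hww := Unitary.star_mul_self_of_mem hw
    set g := v * w * star v with hg
    have hgδ : norm₂ τ (g - condExp τ A g) ≤ δ :=
      norm₂_sub_condExp_le_deltaAt hτ hA hwA (norm_compression hv
        (norm_le_one_of_mem_unitary hw))
    -- Chosen so that gy = q·u(w(uxu)w*)u and yg = xq; the latter gives τ(a*qx) as `q` commutes with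
    -- a*.
    set y := x * (u * star w * u) with hy
    have hyn : ‖y‖ ≤ 1 := by
      rwa [hy, CStarRing.norm_mul_mem_unitary _ (mul_mem (mul_mem hv.swap_mem_unitary
        (Unitary.star_mem hw)) hv.swap_mem_unitary)]
    have hyx : y * (u * w * u) = x := by
      calc _ = x * (u * (star w * (u * u) * w) * u) := by rw [hy]; simp only [mul_assoc]
        _ = x := by rw [hu, mul_one, hww, mul_one, hu, mul_one]
    have e1 : τ (u * star a * q * u * (w * (u * x * u) * star w)) = τ (star a * (g * y)) := by
      rw [hg, ← final_mul_swap_conj hA hv hwA, ← hq, ← hu_def]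
      calc _ = τ (u * (star a * q * u * w * u * x * u * star w)) := by simp only [mul_assoc]
        _ = τ (star a * q * u * w * u * x * u * star w * u) := hτ.tracial _ _
        _ = _ := by rw [hy]; simp only [mul_assoc]
    have e2 : τ (star a * (q * x)) = τ (star a * (y * g)) := by
      rw [hg, ← swap_conj_mul_final hA hv hwA, ← mul_assoc y, hyx, ← mul_assoc,
        hA.commute hsa hv.final_mem, mul_assoc, hτ.tracial, mul_assoc]
    have h := re_trace_commutator_le hτ hA haA hyn g
    have h' := mul_le_mul_of_nonneg_left hgδ ha0
    rw [e1, e2]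
    linarith)
  have hsq : norm₂ τ a ^ 2 = (τ (star a * b)).re - (τ (star a * (q * x))).re := by
    rw [hτ.norm₂_sq, hτ.tracial, ha, trace_condExp_mul hτ hA _ hsa, ← ha, hτ.tracial, mul_sub,
      map_sub, Complex.sub_re]
  have hkey : τ (u * star a * q * u * f) = τ (star a * b) := by
    rw [← hqf, mul_assoc, mul_assoc, mul_assoc, hτ.tracial]
    simp only [mul_assoc]
  rw [hkey] at key
  -- At this point ‖a‖₂² ≤ 2δ‖a‖₂.
  have ha2 : norm₂ τ a ≤ 2 * δ := by
    by_contra! hlt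
    nlinarith
  nlinarith

/-- The constant 10 is 5 + 5, from the orthogonal pieces of the difference under vv* and v*v; the
remaining piece vanishes. -/
theorem norm₂_conj_sub_sq_le {x : M.toStarSubalgebra} (hx : ‖x‖ ≤ 1) :
    norm₂ τ (swap v * condExp τ A (swap v * x * swap v) * swap v - condExp τ A x) ^ 2
      ≤ 10 * deltaAt τ A v ^ 2 := by
  have h₁ := hv.mul_star_mul
  have h₂ := hv.mul_self
  have hu := swap_mul_self h₁ h₂
  have hqx := norm₂_final_mul_sub_sq_le hτ hA hv hx
  have hqy := norm₂_final_mul_sub_sq_le hτ hA hv (norm_swap_conj hv hx)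
  have huq := swap_mul_final h₁ h₂
  have hpu := initial_mul_swap h₁ h₂
  have hur := swap_mul_fixed h₁ h₂
  have hru := fixed_mul_swap h₁ h₂
  have hrA : ((1 - v * star v - star v * v : M.toStarSubalgebra) : H →L[ℂ] H) ∈ A :=
    sub_mem (sub_mem (one_mem A) hv.final_mem) hv.initial_mem
  have hqp := hv.orthogonal
  have hqs := hv.final.isSelfAdjoint.star_eq
  have hun := hv.swap_mem_unitary
  have hus := star_swap v
  set u := swap v with hu_def
  set q := v * star v with hq
  set p := star v * v with hp
  set r := 1 - q - p with hr
  have hback : u * (u * x * u) * u = x := by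
    calc _ = u * u * x * (u * u) := by simp only [mul_assoc]
      _ = x := by rw [hu, one_mul, mul_one]
  rw [hback] at hqy
  set f := condExp τ A (u * x * u) with hf
  have hfA : (f : H →L[ℂ] H) ∈ A := condExp_mem hτ hA _
  set D := u * f * u - condExp τ A x with hD
  -- Here ru = ur = r with r in A, so both terms of rD reduce to rE_A(x) by the module property.
  have hrD : r * D = 0 := by
    rw [hD, mul_sub, sub_eq_zero]
    calc r * (u * f * u) = r * u * f * u := by simp only [mul_assoc]
      _ = f * (r * u) := by rw [hru, hA.commute hrA hfA, mul_assoc, hru]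
      _ = condExp τ A (u * x * (u * r)) := by
        rw [hru, ← condExp_mul_right hτ hA _ hrA, mul_assoc _ u r]
      _ = r * condExp τ A (u * x) := by
        rw [hur, condExp_mul_right hτ hA _ hrA, hA.commute (condExp_mem hτ hA _) hrA]
      _ = r * condExp τ A x := by
        rw [← condExp_mul_left hτ hA _ hrA, ← mul_assoc, hru, condExp_mul_left hτ hA _ hrA]
  have hsum : D = q * D + p * D := by
    have : D = q * D + p * D + r * D := by rw [hr]; noncomm_ring
    rwa [hrD, add_zero] at this
  -- Conjugation by u exchanges p and q, and uDu is minus the difference formed from uxu, so the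
  -- bound for `q` applies again.
  have hpD : p * D = -(u * (q * (u * condExp τ A x * u - f)) * star u) := by
    have : u * D * u = f - u * condExp τ A x * u := by
      rw [hD]
      calc _ = u * u * f * (u * u) - u * condExp τ A x * u := by noncomm_ring
        _ = _ := by rw [hu, one_mul, mul_one]
    calc p * D = p * (u * u) * D * (u * u) := by rw [hu, mul_one, mul_one]
      _ = p * u * (u * D * u) * u := by simp only [mul_assoc]
      _ = u * q * (f - u * condExp τ A x * u) * u := by rw [hpu, huq, this]
      _ = _ := by rw [hus]; noncomm_ring
  have hortho : star (q * D) * (p * D) = 0 := by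
    calc _ = star D * (q * p) * D := by rw [star_mul, hqs]; simp only [mul_assoc]
      _ = 0 := by rw [hqp]; simp
  rw [hsum, hτ.norm₂_add_sq, hortho, hpD, IsNormalizedTrace.norm₂_neg, hτ.norm₂_conj hun]
  simp only [map_zero, Complex.zero_re]
  linarith

/-- E_A(v) = qE_A(v) = E_A(v)q = E_A(vq) = 0, and likewise for v*; this leaves v + v*, whose
summands are orthogonal because (v*)² = 0. -/
theorem norm₂_swap_sub_condExp :
    norm₂ τ (swap v - condExp τ A (swap v)) = √2 * norm₂ τ (star v * v) := by
  have h₁ := hv.mul_star_mul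
  have h₂ := hv.mul_self
  have h₃ := star_mul_mul_star h₁
  have h₄ := star_mul_star h₂
  have e1 : condExp τ A v = 0 := by
    have : condExp τ A v = condExp τ A 0 := by
      calc _ = condExp τ A (v * star v * v) := by rw [h₁]
        _ = condExp τ A (v * (v * star v)) := by
          rw [condExp_mul_left hτ hA _ hv.final_mem, condExp_mul_right hτ hA _ hv.final_mem,
            hA.commute hv.final_mem (condExp_mem hτ hA _)]
        _ = _ := by rw [← mul_assoc, h₂, zero_mul]
    rw [this, condExp_of_mem hτ (zero_mem A)]
  have e2 : condExp τ A (star v) = 0 := by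
    have : condExp τ A (star v) = condExp τ A 0 := by
      calc _ = condExp τ A (star v * v * star v) := by rw [h₃]
        _ = condExp τ A (star v * (star v * v)) := by
          rw [condExp_mul_left hτ hA _ hv.initial_mem, condExp_mul_right hτ hA _ hv.initial_mem,
            hA.commute hv.initial_mem (condExp_mem hτ hA _)]
        _ = _ := by rw [← mul_assoc, h₄, zero_mul]
    rw [this, condExp_of_mem hτ (zero_mem A)]
  have hrA : ((1 - v * star v - star v * v : M.toStarSubalgebra) : H →L[ℂ] H) ∈ A :=
    sub_mem (sub_mem (one_mem A) hv.final_mem) hv.initial_mem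
  have e3 : swap v - condExp τ A (swap v) = v + star v := by
    rw [swap, condExp_add hτ hA, condExp_add hτ hA, e1, e2, condExp_of_mem hτ hrA]
    abel
  have e4 : norm₂ τ (v + star v) ^ 2 = (√2 * norm₂ τ (star v * v)) ^ 2 := by
    rw [hτ.norm₂_add_sq, hτ.norm₂_star, h₄, mul_pow, Real.sq_sqrt zero_le_two,
      ← hv.norm₂_sq_eq hτ, map_zero, Complex.zero_re]
    ring
  rw [e3]
  exact (pow_left_inj₀ (IsNormalizedTrace.norm₂_nonneg _)
    (mul_nonneg (Real.sqrt_nonneg _) (IsNormalizedTrace.norm₂_nonneg _)) two_ne_zero).1 e4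

theorem IsAlphaStronglySingular.mul_norm₂_le {c : ℝ} (hc : IsAlphaStronglySingular τ A c) :
    c * norm₂ τ (star v * v) ≤ √5 * deltaAt τ A v := by
  have hδ := deltaAt_nonneg (τ := τ) (A := A) v
  have hus := star_swap v
  have hun := hv.swap_mem_unitary
  let U : unitary (H →L[ℂ] H) := ⟨(swap v : M.toStarSubalgebra), Unitary.mem_iff.2
    ⟨congrArg Subtype.val (Unitary.star_mul_self_of_mem hun),
      congrArg Subtype.val (Unitary.mul_star_self_of_mem hun)⟩⟩
  have h := hc U (swap v).2
  have hle : normInfTwo τ (fun x => condExp τ (conj U A) x - condExp τ A x) ≤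
      √2 * (√5 * deltaAt τ A v) := by
    refine Real.sSup_le ?_ (by positivity)
    rintro _ ⟨x, hx, rfl⟩
    dsimp only
    rw [condExp_conj hτ hA U (w := swap v) rfl x, hus]
    refine abs_le_of_sq_le_sq' ?_ (by positivity) |>.2
    rw [mul_pow, mul_pow, Real.sq_sqrt zero_le_two, Real.sq_sqrt (by norm_num), ← mul_assoc]
    exact (norm₂_conj_sub_sq_le hτ hA hv hx).trans_eq (by norm_num)
  have h' : c * (√2 * norm₂ τ (star v * v)) ≤ √2 * (√5 * deltaAt τ A v) := by
    rw [← norm₂_swap_sub_condExp hτ hA hv]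
    exact h.trans hle
  rw [mul_left_comm] at h'
  exact le_of_mul_le_mul_left h' (by positivity)

end estimate

/-! ### Passage to the invariants α and δ -/

theorem IsAlphaStronglySingular.div_sqrt_five_le_delta {τ : M.toStarSubalgebra →ₗ[ℂ] ℂ}
    (hτ : IsNormalizedTrace τ) {A : VonNeumannAlgebra H} (hA : IsMasa M A) {c : ℝ}
    (hc : IsAlphaStronglySingular τ A c) : ((c / √5 : ℝ) : EReal) ≤ delta τ A := by
  refine le_sSup ⟨c / √5, fun v hv => ?_, rfl⟩
  rw [div_mul_eq_mul_div, div_le_iff₀' (by positivity)]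
  exact hc.mul_norm₂_le hτ hA hv

end IIOne

end

theorem theorem7p1 {H : Type*} [NormedAddCommGroup H] [InnerProductSpace ℂ H] [CompleteSpace H]
    (M : VonNeumannAlgebra H) (hM : IIOne.IsTypeIIOneFactor M)
    (τ : M.toStarSubalgebra →ₗ[ℂ] ℂ) (hτ : IIOne.IsNormalizedTrace τ)
    (A : VonNeumannAlgebra H) (hA : IIOne.IsMasa M A) :
    IIOne.alpha τ A / ((√5 : ℝ) : EReal) ≤ IIOne.delta τ A ∧
      (IIOne.IsStronglySingular τ A → ((1 / √5 : ℝ) : EReal) ≤ IIOne.delta τ A) := by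
  refine ⟨?_, fun h => h.div_sqrt_five_le_delta hτ hA⟩
  have h5 : (0 : EReal) < ((√5 : ℝ) : EReal) := EReal.coe_pos.2 (by positivity)
  -- Moving the finite positive factor √5 across lets the supremum defining α be tested on one real
  -- `c` at a time.
  rw [EReal.div_le_iff_le_mul h5 (EReal.coe_ne_top _)]
  refine sSup_le ?_
  rintro _ ⟨c, hc, rfl⟩
  rw [← EReal.div_le_iff_le_mul h5 (EReal.coe_ne_top _), ← EReal.coe_div]
  exact IIOne.IsAlphaStronglySingular.div_sqrt_five_le_delta hτ hA hc
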